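/- Let $H$ be a complex Hilbert space and let $A\subseteq B(H)$ be a norm-closed subalgebra containing the identity operator. Let $a\in A$ be invertible in $A$ with no negative real numbers in its spectrum (relative to $A$), and let $p\ge 1$ be an integer. For an element $x$ of a unital complex algebra and $n\ge1$, a principal $n$-th root of $x$ is an element $y$ with $y^n=x$ whose spectrum lies in $\{z\neq 0:\ |\arg z|<\pi/n\}$; when exactly one exists it is denoted $x^{1/n}$. If the spectrum of $x$ does not meet $i\mathbb R$ and $x^2$ has a unique principal square root, put $\operatorname{sign}(x)=x\,(x^2)^{-1/2}$, where $(x^2)^{-1/2}$ is the inverse of $(x^2)^{1/2}$. For $n\ge 2$ and $b\in A$ let $$C_n(b)=\begin{bmatrix}0&1&0&\cdots&0\\0&0&1&\cdots&0\\ \vdots&\vdots&\vdots&\ddots&\vdots\\0&0&0&\cdots&1\\ b&0&0&\cdots&0\end{bmatrix}\in M_n(A),\qquad \sigma_n=1+2\sum_{k=1}^{\lfloor n/4\rfloor}\cos\Bigl(\frac{2\pi k}{n}\Bigr).$$ Then $a$ has a unique principal $p$-th root $a^{1/p}$ in $A$, and the following hold. 1. If $p$ is even and $p/2$ is odd, then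 $\operatorname{sign}(C_p(a))$ is defined in $M_p(A)$, and $$a^{1/p}=\frac{p}{2\sigma_p}\,v,$$ where $v$ is the entry of $\operatorname{sign}(C_p(a))$ in row $2$ and column $1$. The entry $w$ in row $1$ and column $2$ satisfies $(a^{1/p})^{-1}=\frac{p}{2\sigma_p}\,w$. 2. If $p=2^kq$ with $k\ge 0$, $q$ even and $q/2$ odd, then $b=a^{1/2^k}$ is defined (the principal root exists and is unique), $\operatorname{sign}(C_q(b))$ is defined, and $a^{1/p}=\frac{q}{2\sigma_q}\,v$, where $v$ is the row $2$, column $1$ entry of $\operatorname{sign}(C_q(b))$. 3. If $p$ is odd and the spectrum of $a$ lies in the open right half plane, then $\operatorname{sign}(C_{2p}(a^2))$ is defined, and $a^{1/p}=\frac{2p}{2\sigma_{2p}}\,v$, where $v$ is the row $2$, column $1$ entry of $\operatorname{sign}(C_{2p}(a^2))$. -/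

import Mathlib

/-- `y` is a principal `n`-th root of `x`: an `n`-th root all of whose spectrum lies in the open
sector of nonzero complex numbers with argument in `(-π/n, π/n)`.  The spectrum is the one relative
to the algebra `R`. -/
def IsPrincipalRoot {R : Type*} [Ring R] [Algebra ℂ R] (n : ℕ) (x y : R) : Prop :=
  y ^ n = x ∧ ∀ z ∈ spectrum ℂ y, z ≠ 0 ∧ |Complex.arg z| < Real.pi / n

open Classical in
/-- The principal root `x^{1/n}` (with the value `0` if there is no principal `n`-th root). -/
noncomputable def principalRoot {R : Type*} [Ring R] [Algebra ℂ R] (n : ℕ) (x : R) : R :=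
  if h : ∃ y, IsPrincipalRoot n x y then h.choose else 0

/-- `sign(x)` is meaningful: the spectrum of `x` does not meet the imaginary axis, and `x²` has
exactly one principal square root. -/
def SignDefined {R : Type*} [Ring R] [Algebra ℂ R] (x : R) : Prop :=
  (∀ z ∈ spectrum ℂ x, z.re ≠ 0) ∧ ∃! y, IsPrincipalRoot 2 (x ^ 2) y

/-- `sign(x) = x (x²)^{-1/2}`. -/
noncomputable def opSign {R : Type*} [Ring R] [Algebra ℂ R] (x : R) : R :=
  x * Ring.inverse (principalRoot 2 (x ^ 2))

/-- The `p × p` block companion matrix with `1` on the first superdiagonal, `a` in the lower left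
corner, and `0` elsewhere. -/
def blockCompanion {R : Type*} [Ring R] (p : ℕ) (a : R) : Matrix (Fin p) (Fin p) R :=
  Matrix.of fun i j =>
    if (i : ℕ) + 1 = j then 1 else if (i : ℕ) + 1 = p ∧ (j : ℕ) = 0 then a else 0

/-- `σ = 1 + 2 ∑_{k=1}^{⌊p/4⌋} cos(2πk/p)`. -/
noncomputable def sigmaConst (p : ℕ) : ℝ :=
  1 + 2 * ∑ k ∈ Finset.Icc 1 (p / 4), Real.cos (2 * Real.pi * k / p)

/-! Write `u` for the principal `p`-th root of `a` and `ω = exp (2πi/p)`. The columns `(1, ω^k u,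
(ω^k u)^2, …)` are eigenvectors of the companion matrix for the "eigenvalues" `ω^k u`, so a block
Fourier matrix `V` gives `C_p(a) = V diag(ω^k u) V⁻¹` (`blockCompanion_eq_blockFourierDiagonal`). If
`p/2` is odd, every `ω^k` is at angular distance at least `π/p` from the imaginary axis, while the
spectrum of `u` lies in `|arg z| < π/p`; multiplying by `u` therefore moves no `ω^k` across the axis
(`re_signRe_mul_pos`). With `ε_k = ±1` the sign of `Re ω^k`, the matrix `V diag(ε_k ω^k u) V⁻¹` is
the principal square root of `C_p(a)^2`, so `sign(C_p(a)) = V diag(ε_k) V⁻¹`. Its row 2, column 1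
entry is `p⁻¹ (∑ ε_k ω^k) u`, and a trigonometric count evaluates the sum as `2σ_p`
(`sum_signRe_mul_rootOfUnity`).

The remaining cases reduce to this one by composing roots. Existence and uniqueness of principal
roots, in `A` and in its matrix algebras, hold in any complex Banach algebra
(`existsUnique_isPrincipalRoot`), by passing to commutative subalgebras and using characters. -/

/-! ### Logarithms and commutative subalgebras of Banach algebras -/

open Complex in
/-- In a commutative complex Banach algebra an element whose spectrum lies in the slit plane has a
logarithm on which every character takes the principal value. -/
theorem exists_exp_eq_of_spectrum_subset_slitPlane {R : Type*} [NormedCommRing R]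
    [NormedAlgebra ℂ R] [CompleteSpace R] {a : R} (ha : spectrum ℂ a ⊆ slitPlane) :
    ∃ l : R, NormedSpace.exp l = a ∧
      ∀ φ : WeakDual.characterSpace ℂ R, φ l = Complex.log (φ a) := by
  have hφ (φ : WeakDual.characterSpace ℂ R) : 1 + (φ a - 1) ∈ slitPlane := by
    simpa using ha (WeakDual.CharacterSpace.mem_spectrum_iff_exists.2 ⟨φ, rfl⟩)
  -- A non-unit is killed by some character, but characters send this element into the segment from
  -- `1` to `φ a`, which stays in the slit plane.
  have hunit (t : ℝ) (ht : t ∈ Set.Icc (0 : ℝ) 1) : IsUnit (1 + (t : ℂ) • (a - 1)) := by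
    by_contra h
    obtain ⟨φ, h0⟩ := WeakDual.CharacterSpace.exists_apply_eq_zero h
    have hmem := StarConvex.add_smul_mem starConvex_one_slitPlane (hφ φ) ht.1 ht.2
    apply slitPlane_ne_zero hmem
    rw [map_add, map_smul, map_sub, map_one] at h0
    rwa [← Complex.coe_smul]
  set g : ℝ → R := fun t ↦ Ring.inverse (1 + (t : ℂ) • (a - 1)) with hg
  have hgc : ContinuousOn g (Set.Icc 0 1) := fun t ht ↦ by
    obtain ⟨u, hu⟩ := hunit t ht
    refine ContinuousAt.continuousWithinAt ?_
    have h1 : ContinuousAt Ring.inverse (1 + (t : ℂ) • (a - 1)) := by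
      rw [← hu]; exact NormedRing.inverse_continuousAt u
    exact ContinuousAt.comp (f := fun t : ℝ ↦ 1 + (t : ℂ) • (a - 1)) h1 (by fun_prop)
  -- Extending the integrand continuously to all of `ℝ` makes its primitive differentiable at the
  -- endpoints as well.
  set h : ℝ → R := Set.IccExtend zero_le_one ((Set.Icc (0 : ℝ) 1).domRestrict g) with hh
  have hhc : Continuous h := (continuousOn_iff_continuous_domRestrict.1 hgc).Icc_extend'
  have hhg (t : ℝ) (ht : t ∈ Set.Icc (0 : ℝ) 1) : h t = g t := by
    rw [hh, Set.IccExtend_of_mem _ _ ht]; rfl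
  set F : ℝ → R := fun s ↦ (a - 1) * ∫ t in (0 : ℝ)..s, h t with hF
  have hFd (s : ℝ) : HasDerivAt F ((a - 1) * h s) s :=
    (hhc.integral_hasStrictDerivAt 0 s).hasDerivAt.const_mul (a - 1)
  -- The candidate logarithm is `∫₀¹ (a - 1)(1 + t(a - 1))⁻¹ dt`. The product `exp(-F s)(1 + s(a -
  -- 1))` has zero derivative on `[0, 1)` and equals `1` at `0`; at `s = 1` this reads `exp(-F 1) a
  -- = 1`.
  have hG (s : ℝ) : HasDerivAt (fun s : ℝ ↦ NormedSpace.exp (-F s) * (1 + (s : ℂ) • (a - 1)))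
      (NormedSpace.exp (-F s) * -((a - 1) * h s) * (1 + (s : ℂ) • (a - 1))
        + NormedSpace.exp (-F s) * (a - 1)) s := by
    refine HasDerivAt.mul ?_ ?_
    · have h1 := (hasFDerivAt_exp (𝕂 := ℂ) (x := -F s)).restrictScalars ℝ
      refine HasDerivAt.congr_deriv (h1.comp_hasDerivAt s (hFd s).neg) ?_
      simp
    · have h2 : HasDerivAt (fun s : ℝ ↦ (s : ℂ)) 1 s := Complex.ofRealCLM.hasDerivAt
      simpa using (h2.smul_const (a - 1)).const_add 1
  have hconst := constant_of_has_deriv_right_zero (a := (0 : ℝ)) (b := 1)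
    (fun s _ ↦ (hG s).continuousAt.continuousWithinAt) (fun s hs ↦ by
      have hs' : s ∈ Set.Icc (0 : ℝ) 1 := ⟨hs.1, hs.2.le⟩
      have h3 : h s * (1 + (s : ℂ) • (a - 1)) = 1 := by
        rw [hhg s hs']; exact Ring.inverse_mul_cancel _ (hunit s hs')
      have h4 := (hG s).hasDerivWithinAt (s := Set.Ici s)
      convert h4 using 1
      linear_combination (NormedSpace.exp (-F s) * (a - 1)) * h3) 1 (by simp)
  refine ⟨F 1, ?_, fun φ ↦ ?_⟩
  · have h5 : NormedSpace.exp (-F 1) * a = 1 := by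
      simpa [hF] using hconst
    let _ : NormedAlgebra ℚ R := NormedAlgebra.restrictScalars ℚ ℂ R
    have h6 : NormedSpace.exp (F 1) * NormedSpace.exp (-F 1) = 1 := by
      rw [← NormedSpace.exp_add]; simp
    calc NormedSpace.exp (F 1) = NormedSpace.exp (F 1) * (NormedSpace.exp (-F 1) * a) := by
          rw [h5, mul_one]
      _ = a := by rw [← mul_assoc, h6, one_mul]
  · have h7 : φ (∫ t in (0 : ℝ)..1, h t) = ∫ t in (0 : ℝ)..1, φ (h t) :=
      ((WeakDual.CharacterSpace.toCLM φ).intervalIntegral_comp_comm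
        (hhc.intervalIntegrable 0 1)).symm
    have h8 := log_eq_integral (hφ φ)
    rw [add_sub_cancel] at h8
    rw [h8, hF]
    simp only [map_mul, map_sub, map_one, h7]
    congr 1
    refine intervalIntegral.integral_congr fun t ht ↦ ?_
    rw [Set.uIcc_of_le zero_le_one] at ht
    have h9 := congrArg φ (Ring.inverse_mul_cancel _ (hunit t ht))
    rw [map_mul, map_add, map_smul, map_sub, map_one] at h9
    simp only [hhg t ht]
    exact eq_inv_of_mul_eq_one_left h9

/-- The elements of a complex Banach algebra commuting with everything that commutes with a
commuting set form a commutative Banach algebra in which the spectrum does not change. -/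
theorem exists_commutative_bicommutant.{u} {B : Type u} [NormedRing B] [NormedAlgebra ℂ B]
    [CompleteSpace B] (S : Set B) (hS : S ⊆ S.centralizer) :
    ∃ (R : Type u) (_ : NormedCommRing R) (_ : NormedAlgebra ℂ R) (_ : CompleteSpace R)
      (f : R →ₐ[ℂ] B), Function.Injective f ∧ (∀ x, spectrum ℂ (f x) = spectrum ℂ x) ∧
        Set.range f = S.centralizer.centralizer := by
  let T : Subalgebra ℂ B := Subalgebra.centralizer ℂ S.centralizer
  have hT (x : B) : x ∈ T ↔ x ∈ S.centralizer.centralizer := Iff.rfl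
  have hcomm (x y : T) : x * y = y * x :=
    Subtype.ext (y.2 x (Set.centralizer_subset hS x.2))
  have hclosed : IsClosed (T : Set B) := Set.isClosed_centralizer _
  refine ⟨T, { (inferInstance : NormedRing T) with mul_comm := hcomm },
    (inferInstance : NormedAlgebra ℂ T), hclosed.completeSpace_coe, T.val,
    Subtype.val_injective, fun x ↦ ?_, by ext x; simp [hT]⟩
  ext z
  rw [spectrum.mem_iff, spectrum.mem_iff, not_iff_not]
  constructor
  · intro h
    obtain ⟨v, h1, h2⟩ := isUnit_iff_exists.1 h
    have hw : (algebraMap ℂ T z - x : T).1 = algebraMap ℂ B z - T.val x := rfl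
    -- An inverse commutes with whatever the element commutes with, so inverses taken in `B` already
    -- lie in `T`.
    have hv : v ∈ T := fun c hc ↦ by
      have h3 : c * (algebraMap ℂ B z - T.val x) = (algebraMap ℂ B z - T.val x) * c :=
        (algebraMap ℂ T z - x : T).2 c hc
      calc c * v = v * (algebraMap ℂ B z - T.val x) * c * v := by rw [h2, one_mul]
        _ = v * (c * (algebraMap ℂ B z - T.val x)) * v := by rw [h3, mul_assoc v]
        _ = v * c * ((algebraMap ℂ B z - T.val x) * v) := by simp only [mul_assoc]
        _ = v * c := by rw [h1, mul_one]
    exact isUnit_iff_exists.2 ⟨⟨v, hv⟩, Subtype.ext h1, Subtype.ext h2⟩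
  · intro h
    exact h.map T.val

/-! ### Existence, uniqueness and composition of principal roots -/

section PrincipalRoot

theorem Complex.arg_pow_of_abs_lt {z : ℂ} {n : ℕ} (hn : n ≠ 0) (hz : |z.arg| < Real.pi / n) :
    (z ^ n).arg = n * z.arg := by
  have hn' : (0 : ℝ) < n := by positivity
  obtain ⟨h1, h2⟩ := abs_lt.1 hz
  have hmul : (n : ℝ) * (Real.pi / n) = Real.pi := by field_simp
  rw [← Complex.arg_coe_angle_toReal_eq_arg, Complex.arg_pow_coe_angle, ← Real.Angle.coe_nsmul,
    nsmul_eq_mul, Real.Angle.toReal_coe_eq_self_iff]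
  constructor <;> nlinarith

theorem Complex.eq_of_pow_eq_of_abs_arg_lt {z w : ℂ} {n : ℕ} (hn : n ≠ 0)
    (hz : |z.arg| < Real.pi / n) (hw : |w.arg| < Real.pi / n) (h : z ^ n = w ^ n) : z = w := by
  rw [abs_lt] at hz hw
  rw [← Complex.pow_cpow_nat_inv hn hz.1 hz.2.le, h, Complex.pow_cpow_nat_inv hn hw.1 hw.2.le]

theorem IsPrincipalRoot.isUnit {R : Type*} [Ring R] [Algebra ℂ R] {n : ℕ} {x y : R}
    (h : IsPrincipalRoot n x y) : IsUnit y :=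
  spectrum.isUnit_of_zero_notMem ℂ fun h0 ↦ (h.2 0 h0).1 rfl

/-- Existence: `exp(l/n)` for the principal logarithm `l`, built in the bicommutant of `x`.
Uniqueness: any other root commutes with this one, and in a commutative algebra containing both the
factorization of `t^n - s^n` has an invertible cofactor of `t - s`. -/
theorem existsUnique_isPrincipalRoot {B : Type*} [NormedRing B] [NormedAlgebra ℂ B]
    [CompleteSpace B] {x : B} (hx : spectrum ℂ x ⊆ Complex.slitPlane) {n : ℕ} (hn : n ≠ 0) :
    ∃! y, IsPrincipalRoot n x y := by
  have hn0 : (n : ℂ) ≠ 0 := by exact_mod_cast hn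
  have hn1 : (0 : ℝ) < n := by positivity
  obtain ⟨R, _, _, _, f, -, hspec, hrange⟩ := exists_commutative_bicommutant {x}
    (by simp [Set.mem_centralizer_iff])
  obtain ⟨x, rfl⟩ : ∃ x', f x' = x := by
    change x ∈ Set.range f
    rw [hrange]
    exact Set.subset_centralizer_centralizer rfl
  rw [hspec] at hx
  obtain ⟨l, hl, hlog⟩ := exists_exp_eq_of_spectrum_subset_slitPlane hx
  let _ : NormedAlgebra ℚ R := NormedAlgebra.restrictScalars ℚ ℂ R
  set y : R := NormedSpace.exp ((n : ℂ)⁻¹ • l) with hy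
  have hyn : y ^ n = x := by
    rw [hy, ← NormedSpace.exp_nsmul, ← Nat.cast_smul_eq_nsmul ℂ, smul_smul, mul_inv_cancel₀ hn0,
      one_smul, hl]
  have hyroot : IsPrincipalRoot n (f x) (f y) := by
    refine ⟨by rw [← map_pow, hyn], fun z hz ↦ ?_⟩
    rw [hspec, WeakDual.CharacterSpace.mem_spectrum_iff_exists] at hz
    obtain ⟨φ, rfl⟩ := hz
    have hφ : φ y = Complex.exp (Complex.log (φ x) / n) := by
      rw [hy, Complex.exp_eq_exp_ℂ, NormedSpace.map_exp φ (map_continuous φ), map_smul, hlog]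
      congr 1
      rw [smul_eq_mul]; ring
    have hx0 : φ x ∈ Complex.slitPlane :=
      hx (WeakDual.CharacterSpace.mem_spectrum_iff_exists.2 ⟨φ, rfl⟩)
    have harg : |(φ x).arg| < Real.pi :=
      abs_lt.2 ⟨Complex.neg_pi_lt_arg _, (Complex.arg_le_pi _).lt_of_ne
        (Complex.mem_slitPlane_iff_arg.1 hx0).1⟩
    have him : (Complex.log (φ x) / n).im = (φ x).arg / n := by
      rw [Complex.div_natCast_im, Complex.log_im]
    have hlt : |(φ x).arg / n| < Real.pi / n := by
      rw [abs_div, Nat.abs_cast]; gcongr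
    have hle : Real.pi / n ≤ Real.pi :=
      div_le_self Real.pi_pos.le (by exact_mod_cast Nat.one_le_iff_ne_zero.2 hn)
    refine ⟨by rw [hφ]; exact Complex.exp_ne_zero _, ?_⟩
    rw [hφ, ← Complex.log_im, Complex.log_exp, him]
    · exact hlt
    · rw [him]; linarith [(abs_lt.1 hlt).1]
    · rw [him]; linarith [(abs_lt.1 hlt).2]
  refine ⟨f y, hyroot, fun v hv ↦ ?_⟩
  -- `v` commutes with `x = v^n`, and `y` lies in the bicommutant of `x`.
  have hcomm : f y * v = v * f y := by
    have h1 : f y ∈ Set.centralizer (Set.centralizer {f x}) := hrange ▸ ⟨y, rfl⟩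
    refine (h1 v ?_).symm
    rintro _ rfl
    rw [← hv.1]
    exact (Commute.refl v).pow_left n
  obtain ⟨R', _, _, _, g, hinj, hspec', hrange'⟩ := exists_commutative_bicommutant {f y, v} (by
    rintro _ (rfl | rfl) _ (rfl | rfl) <;> first | rfl | exact hcomm | exact hcomm.symm)
  have hmem (w : B) (hw : w ∈ ({f y, v} : Set B)) : ∃ w', g w' = w := by
    change w ∈ Set.range g
    rw [hrange']
    exact Set.subset_centralizer_centralizer hw
  obtain ⟨s, hs⟩ := hmem (f y) (by simp)
  obtain ⟨t, rfl⟩ := hmem v (by simp)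
  rw [← hs] at hyroot ⊢
  have hts : t ^ n = s ^ n := hinj (by rw [map_pow, map_pow, hyroot.1, hv.1])
  -- Each character takes the same value on `s` and `t`, since `n`-th roots in the sector are unique
  -- in `ℂ`; so it sends the sum to `n φ(s)^(n-1) ≠ 0`.
  have hsum : IsUnit (∑ i ∈ Finset.range n, t ^ i * s ^ (n - 1 - i)) := by
    by_contra h
    obtain ⟨φ, h0⟩ := WeakDual.CharacterSpace.exists_apply_eq_zero h
    have hsec {w : R'} (hw : IsPrincipalRoot n (f x) (g w)) : φ w ≠ 0 ∧ |(φ w).arg| < Real.pi / n :=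
      hw.2 _ (by rw [hspec']; exact WeakDual.CharacterSpace.mem_spectrum_iff_exists.2 ⟨φ, rfl⟩)
    have heq : φ t = φ s := Complex.eq_of_pow_eq_of_abs_arg_lt hn (hsec hv).2 (hsec hyroot).2
      (by rw [← map_pow, ← map_pow, hts])
    have h1 : (n : ℂ) * φ s ^ (n - 1) = 0 := by
      rw [← h0, map_sum, ← nsmul_eq_mul]
      conv_lhs => rw [← Finset.card_range n]
      refine (Finset.sum_eq_card_nsmul fun i hi ↦ ?_).symm
      rw [map_mul, map_pow, map_pow, heq, ← pow_add, Finset.card_range]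
      congr 1
      have := Finset.mem_range.1 hi
      omega
    exact mul_ne_zero hn0 (pow_ne_zero _ (hsec hyroot).1) h1
  have hzero : (∑ i ∈ Finset.range n, t ^ i * s ^ (n - 1 - i)) * (t - s) = 0 := by
    rw [(Commute.all t s).geom_sum₂_mul, hts, sub_self]
  rw [sub_eq_zero.1 (hsum.mul_right_eq_zero.1 hzero)]

theorem IsPrincipalRoot.eq_principalRoot {R : Type*} [Ring R] [Algebra ℂ R] {n : ℕ} {x y : R}
    (hx : ∃! y, IsPrincipalRoot n x y) (hy : IsPrincipalRoot n x y) : principalRoot n x = y := by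
  have h : ∃ y, IsPrincipalRoot n x y := hx.exists
  rw [principalRoot, dif_pos h]
  exact hx.unique h.choose_spec hy

theorem spectrum.subset_slitPlane {R : Type*} [Ring R] [Algebra ℂ R] {a : R} (ha : IsUnit a)
    (hneg : ∀ t : ℝ, t < 0 → (t : ℂ) ∉ spectrum ℂ a) : spectrum ℂ a ⊆ Complex.slitPlane := by
  intro z hz
  by_contra h
  obtain ⟨h1, h2⟩ := Complex.mem_slitPlane_iff.not.trans not_or |>.1 h
  have hzr : z = (z.re : ℂ) := Complex.ext rfl (by simpa using h2)
  rcases (not_lt.1 h1).lt_or_eq with h3 | h3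
  · exact hneg _ h3 (hzr ▸ hz)
  · rw [hzr, h3, Complex.ofReal_zero] at hz
    exact spectrum.zero_notMem ℂ ha hz

theorem IsPrincipalRoot.spectrum_subset_slitPlane {R : Type*} [Ring R] [Algebra ℂ R] {n : ℕ}
    (hn : n ≠ 0) {x y : R} (h : IsPrincipalRoot n x y) : spectrum ℂ y ⊆ Complex.slitPlane := by
  intro z hz
  obtain ⟨h0, h1⟩ := h.2 z hz
  refine Complex.mem_slitPlane_iff_arg.2 ⟨fun h2 ↦ ?_, h0⟩
  rw [h2, abs_of_pos Real.pi_pos] at h1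
  exact h1.not_ge (div_le_self Real.pi_pos.le (by exact_mod_cast Nat.one_le_iff_ne_zero.2 hn))

/-- By spectral mapping `w^n` lies in the spectrum of `y`, and `arg (w^n) = n arg w` within the
sector, so the bound `π/m` for `y` becomes `π/(mn)` for `z`. -/
theorem IsPrincipalRoot.trans {R : Type*} [Ring R] [Algebra ℂ R] {m n : ℕ}
    (hn : n ≠ 0) {x y z : R} (hy : IsPrincipalRoot m x y) (hz : IsPrincipalRoot n y z) :
    IsPrincipalRoot (m * n) x z := by
  refine ⟨by rw [mul_comm, pow_mul, hz.1, hy.1], fun w hw ↦ ?_⟩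
  obtain ⟨h0, h1⟩ := hz.2 w hw
  refine ⟨h0, ?_⟩
  have hwn : w ^ n ∈ spectrum ℂ y := by
    rw [← hz.1, spectrum.map_pow_of_pos z (Nat.pos_of_ne_zero hn)]
    exact ⟨w, hw, rfl⟩
  have h2 := (hy.2 _ hwn).2
  rw [Complex.arg_pow_of_abs_lt hn h1, abs_mul, Nat.abs_cast] at h2
  rw [Nat.cast_mul, ← div_div, lt_div_iff₀' (by positivity)]
  exact h2

/-- Spectrum in the right half plane makes `x` itself a principal square root of `x^2`; roots then
compose. -/
theorem IsPrincipalRoot.sq_of_re_pos {R : Type*} [Ring R] [Algebra ℂ R] {n : ℕ} (hn : n ≠ 0)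
    {x y : R} (hx : ∀ z ∈ spectrum ℂ x, 0 < z.re) (hy : IsPrincipalRoot n x y) :
    IsPrincipalRoot (2 * n) (x ^ 2) y := by
  refine .trans hn ⟨rfl, fun z hz ↦ ⟨?_, ?_⟩⟩ hy
  · rintro rfl
    exact (hx 0 hz).ne rfl
  · exact Complex.abs_arg_lt_pi_div_two_iff.2 (.inl (hx z hz))

end PrincipalRoot

/-! ### Signs and sums of roots of unity -/

section Trigonometry

/-- `1` on the open right half plane and `-1` elsewhere. -/
noncomputable def signRe (z : ℂ) : ℂ := if 0 < z.re then 1 else -1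

theorem signRe_mul_self (z : ℂ) : signRe z * signRe z = 1 := by
  unfold signRe; split_ifs <;> norm_num

theorem star_signRe (z : ℂ) : (starRingEnd ℂ) (signRe z) = signRe z := by
  unfold signRe; split_ifs <;> simp

theorem signRe_neg_mul {z : ℂ} (hz : z.re ≠ 0) : signRe (-z) * (-z) = signRe z * z := by
  unfold signRe
  rcases hz.lt_or_gt with h | h
  · simp [h, h.not_gt]
  · simp [h, h.not_gt]

/-- Reducing `k` modulo the odd number `m` to `|s| ≤ (m - 1)/2` shifts both angles by the same
multiple of `π`, so the sign changes cancel. The reduced angle is at least `π/(2m)` away from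
`±π/2`, and a perturbation by `α` keeps it in the interval where the cosine is positive. -/
theorem cos_mul_cos_add_pos {m : ℕ} (hm : m % 2 = 1) (k : ℕ) {α : ℝ}
    (hα : |α| < Real.pi / (2 * m)) :
    0 < Real.cos (Real.pi * k / m) * Real.cos (Real.pi * k / m + α) := by
  have hm0 : (0 : ℝ) < m := by exact_mod_cast (by omega : 0 < m)
  obtain ⟨q, s, hqs, hs1, hs2⟩ : ∃ q s : ℤ, (k : ℤ) = m * q + s ∧ -(m : ℤ) + 1 ≤ 2 * s ∧
      2 * s ≤ m - 1 := by
    refine ⟨Int.bdiv k m, Int.bmod k m, (Int.bdiv_add_bmod _ _).symm, ?_, ?_⟩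
    · have := @Int.le_bmod k m (by omega); omega
    · have := @Int.bmod_lt k m (by omega); omega
  have hk : Real.pi * k / m = Real.pi * s / m + q * Real.pi := by
    have : (k : ℝ) = m * q + s := by exact_mod_cast hqs
    rw [this]; field_simp; ring
  have h1 : Real.cos (Real.pi * k / m) * Real.cos (Real.pi * k / m + α) =
      Real.cos (Real.pi * s / m) * Real.cos (Real.pi * s / m + α) := by
    rw [hk, add_right_comm, Real.cos_add_int_mul_pi, Real.cos_add_int_mul_pi, mul_mul_mul_comm,
      ← mul_zpow]
    simp
  have hs1' : -(m : ℝ) + 1 ≤ 2 * s := by exact_mod_cast hs1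
  have hs2' : 2 * (s : ℝ) ≤ m - 1 := by exact_mod_cast hs2
  have hub : Real.pi * s / m ≤ Real.pi / 2 - Real.pi / (2 * m) := by
    rw [div_le_iff₀ hm0]
    have : (Real.pi / 2 - Real.pi / (2 * m)) * m = Real.pi * ((m - 1) / 2) := by field_simp
    rw [this]; gcongr; linarith
  have hlb : -(Real.pi / 2 - Real.pi / (2 * m)) ≤ Real.pi * s / m := by
    rw [le_div_iff₀ hm0]
    have : -(Real.pi / 2 - Real.pi / (2 * m)) * m = Real.pi * ((1 - m) / 2) := by
      field_simp; ring
    rw [this]; gcongr; linarith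
  have hpos : 0 < Real.pi / (2 * m) := by positivity
  obtain ⟨h2, h3⟩ := abs_lt.1 hα
  rw [h1]
  exact mul_pos (Real.cos_pos_of_mem_Ioo ⟨by linarith, by linarith⟩)
    (Real.cos_pos_of_mem_Ioo ⟨by linarith, by linarith⟩)

/-- The `k`-th power of the primitive `p`-th root of unity `exp (2πi/p)`. -/
noncomputable def rootOfUnity (p k : ℕ) : ℂ := Complex.exp (2 * Real.pi * Complex.I / p) ^ k

theorem rootOfUnity_eq_exp (p k : ℕ) :
    rootOfUnity p k = Complex.exp ((2 * Real.pi * k / p : ℝ) * Complex.I) := by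
  rw [rootOfUnity, ← Complex.exp_nat_mul]
  congr 1
  push_cast
  ring

theorem rootOfUnity_re (p k : ℕ) : (rootOfUnity p k).re = Real.cos (2 * Real.pi * k / p) := by
  rw [rootOfUnity_eq_exp, Complex.exp_ofReal_mul_I_re]

theorem rootOfUnity_ne_zero (p k : ℕ) : rootOfUnity p k ≠ 0 := by
  rw [rootOfUnity_eq_exp]; exact Complex.exp_ne_zero _

theorem star_rootOfUnity (p k : ℕ) : (starRingEnd ℂ) (rootOfUnity p k) = (rootOfUnity p k)⁻¹ := by
  rw [rootOfUnity_eq_exp, ← Complex.exp_conj, ← Complex.exp_neg, map_mul, Complex.conj_ofReal,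
    Complex.conj_I, mul_neg]

/-- If `p / 2` is odd, then multiplication with a number of argument less than `π / p` does not
move a `p`-th root of unity across the imaginary axis. -/
theorem re_signRe_mul_pos {p : ℕ} (hp : p % 4 = 2) (k : ℕ) {z : ℂ} (h0 : z ≠ 0)
    (hz : |z.arg| < Real.pi / p) :
    0 < (signRe (rootOfUnity p k) * rootOfUnity p k * z).re := by
  obtain ⟨m, hm, rfl⟩ : ∃ m, m % 2 = 1 ∧ p = 2 * m := ⟨p / 2, by omega, by omega⟩
  have hz' : |z.arg| < Real.pi / (2 * m) := by exact_mod_cast hz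
  have hkey := cos_mul_cos_add_pos hm k hz'
  have hθ : 2 * Real.pi * k / (2 * m : ℕ) = Real.pi * k / m := by
    push_cast; rw [mul_assoc, mul_div_mul_left _ _ two_ne_zero]
  have hre : (rootOfUnity (2 * m) k * z).re = ‖z‖ * Real.cos (Real.pi * k / m + z.arg) := by
    conv_lhs => rw [← Complex.norm_mul_exp_arg_mul_I z]
    rw [rootOfUnity_eq_exp, hθ, mul_left_comm, ← Complex.exp_add, ← add_mul, ← Complex.ofReal_add,
      Complex.re_ofReal_mul, Complex.exp_ofReal_mul_I_re]
  have hn : 0 < ‖z‖ := norm_pos_iff.2 h0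
  have hre1 := rootOfUnity_re (2 * m) k
  rw [hθ] at hre1
  rw [mul_assoc, signRe, hre1]
  split_ifs with h
  · rw [one_mul, hre]
    exact mul_pos hn ((mul_pos_iff_of_pos_left h).1 hkey)
  · rw [neg_one_mul, Complex.neg_re, hre, ← mul_neg]
    refine mul_pos hn ?_
    by_contra h'
    exact hkey.not_ge (mul_nonpos_of_nonpos_of_nonneg (not_lt.1 h) (by linarith))

theorem re_rootOfUnity_ne_zero {p : ℕ} (hp : p % 4 = 2) (k : ℕ) : (rootOfUnity p k).re ≠ 0 := by
  intro h
  have hp0 : (0 : ℝ) < p := by exact_mod_cast (by omega : 0 < p)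
  have := re_signRe_mul_pos hp k one_ne_zero (by simp; positivity)
  rw [mul_one, signRe] at this
  split_ifs at this <;> simp [h] at this

theorem rootOfUnity_add (p k l : ℕ) :
    rootOfUnity p (k + l) = rootOfUnity p k * rootOfUnity p l := pow_add _ _ _

theorem rootOfUnity_half {m : ℕ} (hm : m ≠ 0) : rootOfUnity (2 * m) m = -1 := by
  have hm' : (m : ℝ) ≠ 0 := by exact_mod_cast hm
  rw [rootOfUnity_eq_exp, ← Complex.exp_pi_mul_I]
  congr 3
  push_cast
  field_simp

/-- The summand is unchanged by `z ↦ -z`, hence has period `p/2 = 2r + 1` in `k`. Over one period,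
the terms `k ≤ r` are roots in the right half plane, and the terms `r < k ≤ 2r` are the conjugates
of those with `1 ≤ k ≤ r`; each pair contributes `2 cos(2πk/p)`. -/
theorem sum_signRe_mul_rootOfUnity {p : ℕ} (hp : p % 4 = 2) :
    ∑ k ∈ Finset.range p, signRe (rootOfUnity p k) * rootOfUnity p k = 2 * (sigmaConst p : ℂ) := by
  have hper (k : ℕ) : signRe (rootOfUnity p (p / 2 + k)) * rootOfUnity p (p / 2 + k) =
      signRe (rootOfUnity p k) * rootOfUnity p k := by
    have h2 : rootOfUnity p (p / 2 + k) = -rootOfUnity p k := by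
      obtain ⟨m, rfl⟩ : ∃ m, p = 2 * m := ⟨p / 2, by omega⟩
      rw [rootOfUnity_add, Nat.mul_div_cancel_left _ two_pos, rootOfUnity_half (by omega),
        neg_one_mul]
    rw [h2, signRe_neg_mul (re_rootOfUnity_ne_zero hp k)]
  obtain ⟨r, hr⟩ : ∃ r, p = 4 * r + 2 := ⟨p / 4, by omega⟩
  have hpos (k : ℕ) (hk : k ≤ r) : signRe (rootOfUnity p k) = 1 := by
    rw [signRe, if_pos]
    rw [rootOfUnity_re]
    have hp0 : (0 : ℝ) < p := by exact_mod_cast (by omega : 0 < p)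
    have hkp : 4 * (k : ℝ) < p := by exact_mod_cast (by omega : 4 * k < p)
    refine Real.cos_pos_of_mem_Ioo ⟨?_, ?_⟩
    · have : 0 ≤ 2 * Real.pi * k / p := by positivity
      linarith [Real.pi_pos]
    · rw [div_lt_iff₀ hp0]; nlinarith [Real.pi_pos]
  have hhalf : p = (2 * r + 1) + (2 * r + 1) := by omega
  have hsum1 : ∑ k ∈ Finset.range p, signRe (rootOfUnity p k) * rootOfUnity p k =
      2 * ∑ k ∈ Finset.range (2 * r + 1), signRe (rootOfUnity p k) * rootOfUnity p k := by
    have h := Finset.sum_range_add (fun k ↦ signRe (rootOfUnity p k) * rootOfUnity p k)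
      (2 * r + 1) (2 * r + 1)
    rw [← hhalf] at h
    refine h.trans ((congrArg _ (Finset.sum_congr rfl fun k _ ↦ ?_)).trans (two_mul _).symm)
    rw [← hper k, show p / 2 = 2 * r + 1 by omega]
  -- The two exponents add up to `p/2`, so the root is minus the inverse of `ω^(k+1)`, and `signRe`
  -- removes the minus.
  have hrefl (k : ℕ) (hk : k < r) :
      signRe (rootOfUnity p (r + (r - 1 - k) + 1)) * rootOfUnity p (r + (r - 1 - k) + 1) =
        (rootOfUnity p (k + 1))⁻¹ := by
    have h1 : r + (r - 1 - k) + 1 + (k + 1) = p / 2 + 0 := by omega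
    have h2 : rootOfUnity p (r + (r - 1 - k) + 1) = -(rootOfUnity p (k + 1))⁻¹ := by
      have h3 := rootOfUnity_add p (r + (r - 1 - k) + 1) (k + 1)
      obtain ⟨m, rfl⟩ : ∃ m, p = 2 * m := ⟨p / 2, by omega⟩
      rw [h1, Nat.mul_div_cancel_left _ two_pos, add_zero, rootOfUnity_half (by omega)] at h3
      rw [neg_eq_neg_one_mul, h3, mul_assoc, mul_inv_cancel₀ (rootOfUnity_ne_zero _ _), mul_one]
    have h4 : signRe (rootOfUnity p (k + 1))⁻¹ = 1 := by
      rw [← star_rootOfUnity, signRe, Complex.conj_re]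
      exact hpos (k + 1) (by omega)
    have h5 : ((rootOfUnity p (k + 1))⁻¹).re ≠ 0 := by
      rw [← star_rootOfUnity, Complex.conj_re]
      exact re_rootOfUnity_ne_zero hp _
    rw [h2, signRe_neg_mul h5, h4, one_mul]
  rw [hsum1, Finset.sum_range_succ', two_mul r, Finset.sum_range_add,
    ← Finset.sum_range_reflect (fun k ↦ signRe (rootOfUnity p (r + k + 1)) * rootOfUnity p (r + k + 1)) r,
    ← Finset.sum_add_distrib, sigmaConst, show p / 4 = r by omega]
  have h0 : rootOfUnity p 0 = 1 := pow_zero _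
  have hIcc : Finset.Icc 1 r = Finset.Ico 1 (r + 1) := by ext; simp
  rw [hpos 0 (by omega), h0, one_mul, hIcc, Finset.sum_Ico_eq_sum_range, add_tsub_cancel_right]
  push_cast
  rw [Finset.mul_sum, add_comm]
  congr 2
  refine Finset.sum_congr rfl fun k hk ↦ ?_
  have hk := Finset.mem_range.1 hk
  rw [hrefl k hk, hpos (k + 1) (by omega), one_mul, ← star_rootOfUnity, Complex.add_conj,
    rootOfUnity_re]
  push_cast
  rw [add_comm (k : ℂ)]

theorem sigmaConst_pos (p : ℕ) : 0 < sigmaConst p := by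
  rw [sigmaConst]
  have : 0 ≤ ∑ k ∈ Finset.Icc 1 (p / 4), Real.cos (2 * Real.pi * k / p) := by
    refine Finset.sum_nonneg fun k hk ↦ ?_
    obtain ⟨h1, h2⟩ := Finset.mem_Icc.1 hk
    have hp : (0 : ℝ) < p := by exact_mod_cast (by omega : 0 < p)
    have hkp : 4 * (k : ℝ) ≤ p := by exact_mod_cast (by omega : 4 * k ≤ p)
    refine Real.cos_nonneg_of_neg_pi_div_two_le_of_le ?_ ?_
    · have : 0 ≤ 2 * Real.pi * k / p := by positivity
      linarith [Real.pi_pos]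
    · rw [div_le_iff₀ hp]; nlinarith [Real.pi_pos]
  linarith

/-- Complex conjugate of the previous sum, whose value is real. -/
theorem sum_signRe_mul_inv_rootOfUnity {p : ℕ} (hp : p % 4 = 2) :
    ∑ k ∈ Finset.range p, signRe (rootOfUnity p k) * (rootOfUnity p k)⁻¹ =
      2 * (sigmaConst p : ℂ) := by
  have h := congrArg (starRingEnd ℂ) (sum_signRe_mul_rootOfUnity hp)
  simpa [map_sum, star_signRe, star_rootOfUnity, map_ofNat (starRingEnd ℂ) 2] using h

end Trigonometry

/-! ### Block Fourier diagonalization of the companion matrix -/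

section BlockCompanion

theorem rootOfUnity_pow (p k i : ℕ) : rootOfUnity p k ^ i = rootOfUnity p i ^ k := by
  simp only [rootOfUnity, ← pow_mul, mul_comm]

theorem rootOfUnity_pow_self {p : ℕ} (hp : p ≠ 0) (k : ℕ) : rootOfUnity p k ^ p = 1 := by
  rw [rootOfUnity, ← pow_mul, mul_comm k, pow_mul, (Complex.isPrimitiveRoot_exp p hp).pow_eq_one,
    one_pow]

theorem sum_rootOfUnity_div_pow {p : ℕ} (i j : Fin p) :
    ∑ k : Fin p, rootOfUnity p i ^ (k : ℕ) * (rootOfUnity p j ^ (k : ℕ))⁻¹ =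
      if i = j then (p : ℂ) else 0 := by
  have hp : p ≠ 0 := i.pos.ne'
  split_ifs with h
  · subst h
    simp [mul_inv_cancel₀ (pow_ne_zero _ (rootOfUnity_ne_zero p i))]
  · have hne : rootOfUnity p i * (rootOfUnity p j)⁻¹ ≠ 1 := by
      rw [Ne, mul_inv_eq_one₀ (rootOfUnity_ne_zero p j)]
      exact fun h' ↦ h (Fin.ext ((Complex.isPrimitiveRoot_exp p hp).pow_inj i.2 j.2 h'))
    have hgeom := mul_geom_sum (rootOfUnity p i * (rootOfUnity p j)⁻¹) p
    rw [mul_pow, inv_pow, rootOfUnity_pow_self hp, rootOfUnity_pow_self hp, inv_one, mul_one,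
      sub_self] at hgeom
    rw [← (mul_eq_zero_iff_left (sub_ne_zero.2 hne)).1 hgeom, ← Fin.sum_univ_eq_sum_range]
    simp only [mul_pow, inv_pow]

variable {A : Type*} [Ring A] [Algebra ℂ A] {p : ℕ}

/-- The block Fourier matrix whose columns are the eigenvectors of the block companion matrix of
`u ^ p`. -/
noncomputable def blockFourier (p : ℕ) (u : Aˣ) : (Matrix (Fin p) (Fin p) A)ˣ where
  val := Matrix.of fun i k ↦ rootOfUnity p k ^ (i : ℕ) • (u : A) ^ (i : ℕ)
  inv := Matrix.of fun k j ↦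
    ((p : ℂ)⁻¹ * (rootOfUnity p k ^ (j : ℕ))⁻¹) • ((u⁻¹ : Aˣ) : A) ^ (j : ℕ)
  val_inv := by
    ext i j
    have hp : (p : ℂ) ≠ 0 := by exact_mod_cast i.pos.ne'
    simp only [Matrix.mul_apply, Matrix.of_apply, smul_mul_smul_comm, ← Finset.sum_smul,
      mul_left_comm _ (p : ℂ)⁻¹, ← Finset.mul_sum]
    simp only [rootOfUnity_pow p _ (i : ℕ), rootOfUnity_pow p _ (j : ℕ), sum_rootOfUnity_div_pow,
      Matrix.one_apply]
    split_ifs with h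
    · rw [inv_mul_cancel₀ hp, one_smul, h, ← Units.val_pow_eq_pow_val, ← Units.val_pow_eq_pow_val,
        ← Units.val_mul, inv_pow, mul_inv_cancel, Units.val_one]
    · rw [mul_zero, zero_smul]
  inv_val := by
    ext k l
    have hp : (p : ℂ) ≠ 0 := by exact_mod_cast k.pos.ne'
    have hu (i : ℕ) : ((u⁻¹ : Aˣ) : A) ^ i * (u : A) ^ i = 1 := by
      rw [← Units.val_pow_eq_pow_val, ← Units.val_pow_eq_pow_val, ← Units.val_mul, inv_pow,
        inv_mul_cancel, Units.val_one]
    simp only [Matrix.mul_apply, Matrix.of_apply, smul_mul_smul_comm, hu, ← Finset.sum_smul,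
      mul_assoc, ← Finset.mul_sum]
    simp only [mul_comm (_⁻¹) (rootOfUnity p _ ^ _), sum_rootOfUnity_div_pow, Matrix.one_apply,
      eq_comm (a := l)]
    split_ifs with h
    · rw [inv_mul_cancel₀ hp, one_smul]
    · rw [mul_zero, zero_smul]

/-- The block matrices that are block diagonal in the basis of columns of `blockFourier`. -/
noncomputable def blockFourierDiagonal (p : ℕ) (u : Aˣ) :
    (Fin p → A) →ₐ[ℂ] Matrix (Fin p) (Fin p) A where
  toFun d := (blockFourier p u).val * Matrix.diagonal d * (blockFourier p u).inv
  map_one' := by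
    change _ * Matrix.diagonal (fun _ ↦ (1 : A)) * _ = 1
    rw [Matrix.diagonal_one, mul_one, Units.val_inv]
  map_mul' d e := by
    change _ * Matrix.diagonal (fun k ↦ d k * e k) * _ = _
    rw [← Matrix.diagonal_mul_diagonal]
    simp only [mul_assoc]
    rw [← mul_assoc (blockFourier p u).inv, Units.inv_val, one_mul]
  map_zero' := by
    change _ * Matrix.diagonal (fun _ ↦ (0 : A)) * _ = 0
    rw [Matrix.diagonal_zero, mul_zero, zero_mul]
  map_add' d e := by
    change _ * Matrix.diagonal (fun k ↦ d k + e k) * _ = _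
    rw [← Matrix.diagonal_add, mul_add, add_mul]
  commutes' c := by
    have h : Matrix.diagonal (algebraMap ℂ (Fin p → A) c) =
        algebraMap ℂ (Matrix (Fin p) (Fin p) A) c := (Matrix.algebraMap_eq_diagonal c).symm
    rw [h, ← Algebra.commutes, mul_assoc, Units.val_inv, mul_one]

theorem spectrum_smul_subset {c : ℂ} (hc : c ≠ 0) {a : A} {z : ℂ} (hz : z ∈ spectrum ℂ (c • a)) :
    ∃ w ∈ spectrum ℂ a, z = c * w := by
  rw [show c • a = Units.mk0 c hc • a from rfl, spectrum.unit_smul_eq_smul] at hz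
  obtain ⟨w, hw, rfl⟩ := hz
  exact ⟨w, hw, rfl⟩

/-- An algebra homomorphism can only shrink the spectrum, and the spectrum in a product is the union
over the factors; this inclusion is all that the sign computation needs. -/
theorem spectrum_blockFourierDiagonal_subset (u : Aˣ) {c : Fin p → ℂ} (hc : ∀ k, c k ≠ 0) {z : ℂ}
    (hz : z ∈ spectrum ℂ (blockFourierDiagonal p u fun k ↦ c k • (u : A))) :
    ∃ k, ∃ w ∈ spectrum ℂ (u : A), z = c k * w := by
  have h := AlgHom.spectrum_apply_subset (blockFourierDiagonal p u) _ hz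
  rw [Pi.spectrum_eq, Set.mem_iUnion] at h
  obtain ⟨k, hk⟩ := h
  exact ⟨k, spectrum_smul_subset (hc k) hk⟩

theorem blockFourierDiagonal_smul_one_apply (u : Aˣ) (c : Fin p → ℂ) (i j : Fin p) :
    blockFourierDiagonal p u (fun k ↦ c k • 1) i j =
      ((p : ℂ)⁻¹ * ∑ k : Fin p, c k * (rootOfUnity p k ^ (i : ℕ) * (rootOfUnity p k ^ (j : ℕ))⁻¹)) •
        ((u : A) ^ (i : ℕ) * ((u⁻¹ : Aˣ) : A) ^ (j : ℕ)) := by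
  change ((blockFourier p u).val * Matrix.diagonal (fun k ↦ c k • (1 : A)) *
    (blockFourier p u).inv : Matrix (Fin p) (Fin p) A) i j = _
  rw [Matrix.mul_apply]
  simp only [Matrix.mul_diagonal, blockFourier, Matrix.of_apply, smul_mul_smul_comm, mul_one,
    Finset.mul_sum, Finset.sum_smul]
  refine Finset.sum_congr rfl fun k _ ↦ ?_
  congr 1
  ring

theorem blockCompanion_eq_blockFourierDiagonal (u : Aˣ) :
    blockCompanion p ((u : A) ^ p) =
      blockFourierDiagonal p u fun k ↦ rootOfUnity p k • (u : A) := by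
  change _ = (blockFourier p u).val * Matrix.diagonal _ * (blockFourier p u).inv
  suffices h : blockCompanion p ((u : A) ^ p) * (blockFourier p u).val =
      (blockFourier p u).val * Matrix.diagonal fun k : Fin p ↦ rootOfUnity p k • (u : A) by
    rw [← h, mul_assoc, Units.val_inv, mul_one]
  ext i k
  rw [Matrix.mul_diagonal, Matrix.mul_apply]
  simp only [blockFourier, Matrix.of_apply, blockCompanion, smul_mul_smul_comm, ← pow_succ]
  by_cases hi : (i : ℕ) + 1 = p
  -- In the last row only the corner `u^p` contributes, and it matches because `(ω^k)^p = 1`.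
  · rw [Fintype.sum_eq_single ⟨0, i.pos⟩ fun j hj ↦ ?_]
    · simp [hi, i.pos.ne', rootOfUnity_pow_self i.pos.ne']
    · have h1 : (i : ℕ) + 1 ≠ j := by omega
      have h2 : (j : ℕ) ≠ 0 := fun h ↦ hj (Fin.ext h)
      simp [h1, h2]
  · rw [Fintype.sum_eq_single ⟨i + 1, by omega⟩ fun j hj ↦ ?_]
    · simp
    · have h1 : (i : ℕ) + 1 ≠ j := fun h ↦ hj (Fin.ext h.symm)
      simp [h1, hi]

end BlockCompanion

/-! ### The sign of the companion matrix -/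

section Sign

variable {B : Type*} [NormedRing B] [NormedAlgebra ℂ B] [CompleteSpace B]

-- The norm serves only to make the matrices a Banach algebra; principal roots are a purely
-- algebraic notion.
attribute [local instance] Matrix.linftyOpNormedRing Matrix.linftyOpNormedAlgebra in
theorem existsUnique_isPrincipalRoot_matrix {ι : Type*} [Fintype ι] [DecidableEq ι]
    {x : Matrix ι ι B} (hx : spectrum ℂ x ⊆ Complex.slitPlane) {n : ℕ} (hn : n ≠ 0) :
    ∃! y, IsPrincipalRoot n x y :=
  @existsUnique_isPrincipalRoot _ _ _ (inferInstanceAs (CompleteSpace (ι → ι → B))) x hx n hn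

/-- `Y`, with diagonal `ε_k ω^k u`, squares to `C^2` because `ε_k^2 = 1`, and has spectrum in the
right half plane; so it is the principal square root of `C^2`. From `S Y = C` follows `sign(C) = S`,
whose entries are explicit. -/
theorem sign_blockCompanion {p : ℕ} (hp : p % 4 = 2) {a y : B} (hy : IsPrincipalRoot p a y) :
    SignDefined (blockCompanion p a) ∧
      y = ((p : ℂ) / (2 * (sigmaConst p : ℂ))) •
        opSign (blockCompanion p a) ⟨1, by omega⟩ ⟨0, by omega⟩ ∧
      Ring.inverse y = ((p : ℂ) / (2 * (sigmaConst p : ℂ))) •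
        opSign (blockCompanion p a) ⟨0, by omega⟩ ⟨1, by omega⟩ := by
  obtain ⟨u, rfl⟩ := hy.isUnit
  have hp0 : (p : ℂ) ≠ 0 := by exact_mod_cast (by omega : p ≠ 0)
  have hσ : (sigmaConst p : ℂ) ≠ 0 := by exact_mod_cast (sigmaConst_pos p).ne'
  have hsign0 (z : ℂ) : signRe z ≠ 0 := left_ne_zero_of_mul_eq_one (signRe_mul_self z)
  set C := blockCompanion p a with hC
  set Y := blockFourierDiagonal p u fun k ↦ (signRe (rootOfUnity p k) * rootOfUnity p k) • (u : B)
    with hY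
  set S := blockFourierDiagonal p u fun k ↦ signRe (rootOfUnity p k) • (1 : B) with hS
  have hCF : C = blockFourierDiagonal p u fun k ↦ rootOfUnity p k • (u : B) := by
    rw [hC, ← hy.1, blockCompanion_eq_blockFourierDiagonal]
  have hSY : S * Y = C := by
    rw [hCF, hS, hY, ← map_mul]
    congr 1
    ext k
    rw [Pi.mul_apply, smul_mul_smul_comm, one_mul, ← mul_assoc, signRe_mul_self, one_mul]
  have hYsq : Y ^ 2 = C ^ 2 := by
    rw [hCF, hY, ← map_pow, ← map_pow]
    congr 1
    ext k
    rw [Pi.pow_apply, Pi.pow_apply, smul_pow, smul_pow, mul_pow, sq (signRe _), signRe_mul_self,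
      one_mul]
  have hYre (z : ℂ) (hz : z ∈ spectrum ℂ Y) : 0 < z.re := by
    obtain ⟨k, w, hw, rfl⟩ := spectrum_blockFourierDiagonal_subset u
      (fun k ↦ mul_ne_zero (hsign0 _) (rootOfUnity_ne_zero p k)) hz
    exact re_signRe_mul_pos hp k (hy.2 w hw).1 (hy.2 w hw).2
  have hYroot : IsPrincipalRoot 2 (C ^ 2) Y := by
    refine ⟨hYsq, fun z hz ↦ ⟨?_, Complex.abs_arg_lt_pi_div_two_iff.2 (.inl (hYre z hz))⟩⟩
    rintro rfl
    exact (hYre 0 hz).ne rfl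
  have hCsq : spectrum ℂ (C ^ 2) ⊆ Complex.slitPlane := by
    rw [← hYsq, spectrum.map_pow_of_pos Y two_pos]
    rintro _ ⟨z, hz, rfl⟩
    have h := hYre z hz
    rw [Complex.mem_slitPlane_iff]
    by_cases him : z.im = 0
    · left; simp [sq, him, h.ne']
    · right; simp [sq, him, h.ne', mul_comm, ← two_mul]
  have huniq := existsUnique_isPrincipalRoot_matrix hCsq two_ne_zero
  have hsgn : opSign C = S := by
    rw [opSign, hYroot.eq_principalRoot huniq]
    conv_lhs => rw [← hSY]
    rw [mul_assoc, Ring.mul_inverse_cancel _ hYroot.isUnit, mul_one]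
  refine ⟨⟨fun z hz ↦ ?_, huniq⟩, ?_, ?_⟩
  · rw [hCF] at hz
    obtain ⟨k, w, hw, rfl⟩ := spectrum_blockFourierDiagonal_subset u
      (fun k : Fin p ↦ rootOfUnity_ne_zero p k) hz
    have h := re_signRe_mul_pos hp k (hy.2 w hw).1 (hy.2 w hw).2
    intro h0
    rw [mul_assoc, signRe] at h
    split_ifs at h <;> simp [h0] at h
  -- The entry is `p⁻¹ (∑ ε_k ω^k) u = (2σ/p) u`; the opposite entry below has `ω^(-k)` and `u⁻¹`
  -- instead.
  · have hsum := sum_signRe_mul_rootOfUnity hp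
    rw [← Fin.sum_univ_eq_sum_range (fun k ↦ signRe (rootOfUnity p k) * rootOfUnity p k)] at hsum
    rw [hsgn, hS, blockFourierDiagonal_smul_one_apply]
    simp only [pow_one, pow_zero, inv_one, mul_one, hsum, smul_smul]
    rw [show (p : ℂ) / (2 * sigmaConst p) * ((p : ℂ)⁻¹ * (2 * sigmaConst p)) = 1 by field_simp,
      one_smul]
  · have hsum := sum_signRe_mul_inv_rootOfUnity hp
    rw [← Fin.sum_univ_eq_sum_range (fun k ↦ signRe (rootOfUnity p k) * (rootOfUnity p k)⁻¹)]
      at hsum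
    rw [hsgn, hS, blockFourierDiagonal_smul_one_apply]
    simp only [pow_one, pow_zero, one_mul, hsum, smul_smul, Ring.inverse_unit]
    rw [show (p : ℂ) / (2 * sigmaConst p) * ((p : ℂ)⁻¹ * (2 * sigmaConst p)) = 1 by field_simp,
      one_smul]

end Sign

/-! ### The main theorem -/

theorem theorem7p3 {H : Type*} [NormedAddCommGroup H] [InnerProductSpace ℂ H] [CompleteSpace H]
    (A : Subalgebra ℂ (H →L[ℂ] H)) (hA : IsClosed (A : Set (H →L[ℂ] H)))
    (a : A) (ha : IsUnit a) (hneg : ∀ t : ℝ, t < 0 → (t : ℂ) ∉ spectrum ℂ a)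
    (p : ℕ) (hp : 0 < p) :
    -- the principal root of `a` exists and is unique
    (∃! y : A, IsPrincipalRoot p a y) ∧
    -- the case in which `p / 2` is an odd integer
    (∀ h2 : p % 4 = 2,
      SignDefined (blockCompanion p a) ∧
      principalRoot p a = ((p : ℂ) / (2 * (sigmaConst p : ℂ))) •
        opSign (blockCompanion p a) ⟨1, by omega⟩ ⟨0, by omega⟩ ∧
      Ring.inverse (principalRoot p a) = ((p : ℂ) / (2 * (sigmaConst p : ℂ))) •
        opSign (blockCompanion p a) ⟨0, by omega⟩ ⟨1, by omega⟩) ∧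
    -- `p` divisible by `4`: divide `p` by `2` and take square roots of `a`, `k` times in all
    (∀ k q : ℕ, ∀ hq : q % 4 = 2, p = 2 ^ k * q →
      (∃! b : A, IsPrincipalRoot (2 ^ k) a b) ∧
      SignDefined (blockCompanion q (principalRoot (2 ^ k) a)) ∧
      principalRoot p a = ((q : ℂ) / (2 * (sigmaConst q : ℂ))) •
        opSign (blockCompanion q (principalRoot (2 ^ k) a)) ⟨1, by omega⟩ ⟨0, by omega⟩) ∧
    -- `p` odd: replace `p` by `2 p` and `a` by `a ^ 2`
    (∀ hodd : p % 2 = 1, (∀ z ∈ spectrum ℂ a, 0 < z.re) →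
      SignDefined (blockCompanion (2 * p) (a ^ 2)) ∧
      principalRoot p a = (((2 * p : ℕ) : ℂ) / (2 * (sigmaConst (2 * p) : ℂ))) •
        opSign (blockCompanion (2 * p) (a ^ 2)) ⟨1, by omega⟩ ⟨0, by omega⟩) := by
  have : CompleteSpace A := hA.completeSpace_coe
  have hspec := spectrum.subset_slitPlane ha hneg
  have huniq (n : ℕ) (hn : n ≠ 0) : ∃! y : A, IsPrincipalRoot n a y :=
    existsUnique_isPrincipalRoot hspec hn
  have hroot (n : ℕ) (hn : n ≠ 0) : IsPrincipalRoot n a (principalRoot n a) := by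
    obtain ⟨y, hy⟩ := (huniq n hn).exists
    rwa [hy.eq_principalRoot (huniq n hn)]
  refine ⟨huniq p hp.ne', fun h2 ↦ sign_blockCompanion h2 (hroot p hp.ne'), ?_, ?_⟩
  · intro k q hq hpq
    have hk : 2 ^ k ≠ 0 := by positivity
    have hb := hroot (2 ^ k) hk
    obtain ⟨y, hy⟩ := (existsUnique_isPrincipalRoot (hb.spectrum_subset_slitPlane hk)
      (by omega : q ≠ 0)).exists
    -- The principal `q`-th root of `a^(1/2^k)` is a principal `p`-th root of `a`, hence the only
    -- one.
    have hyp : principalRoot p a = y :=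
      (hpq ▸ hb.trans (by omega) hy : IsPrincipalRoot p a y).eq_principalRoot (huniq p hp.ne')
    obtain ⟨h1, h2, -⟩ := sign_blockCompanion hq hy
    exact ⟨huniq _ hk, h1, hyp.trans h2⟩
  · intro hodd hre
    -- For odd `p`, `2p` is `2` modulo `4`, and `a^(1/p)` is also the principal `2p`-th root of
    -- `a^2`.
    obtain ⟨h1, h2, -⟩ := sign_blockCompanion (by omega)
      ((hroot p hp.ne').sq_of_re_pos hp.ne' hre)
    exact ⟨h1, h2⟩
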